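/- For $n\ge 0$ let $GT_n:\{0,1\}^n\times\{0,1\}^n\to\{0,1\}$ be the greater-than function, $GT_n(x,y)=1$ iff $x\ge y$, where $x$ and $y$ are read as binary numbers. In a quantum one-way protocol with $c$ qubits of communication, Alice and Bob each own finitely many private qubits, all initialized to $|0\rangle$ (no prior entanglement, no shared randomness); on input $x$ Alice applies a unitary transformation depending on $x$ to her qubits and sends $c$ of them to Bob; on input $y$ Bob applies a unitary transformation depending on $y$ to the received qubits together with his own, and measures one of these qubits, the result being the output. For a function $f:\{0,1\}^n\times\{0,1\}^n\to\{0,1\}$ let $Q^1_\epsilon(f)$ be the least $c$ such that some such protocol outputs $f(x,y)$ with probability at least $1-\epsilon$ for all inputs $x,y$. Let $VC(f)$ be the maximal size of a set $S\subseteq\{0,1\}^n$ such that for every $R\subseteq S$ there is an $x$ with $f(x,y)=1\iff y\in R$ for all $y\in S$. Then for every constant $\epsilon$ with $0<\epsilon<1/2$, $$Q^1_\epsilon(GT_n)=\Omega(n/\log n),$$ that is, there are $C>0$ and $N$ (which may depend on $\epsilon$) such that $Q^1_\epsilon(GT_n)\ge C\,n/\log n$ for all $n\ge N$; whereas $VC(GT_n)=1$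 for all $n\ge 1$. -/

import Mathlib

open Matrix
open scoped Kronecker

/-- Bit strings `{0,1}^q`: the inputs of the players, and also the labels `s` of the standard
basis vectors `|s⟩` of the state space `ℂ^(2^q)` of `q` qubits. -/
abbrev BitString (q : ℕ) : Type := Fin q → Bool

/-- The all-zero string. -/
def zeroString (q : ℕ) : BitString q := fun _ => false

/-- The greater-than function on `n`-bit numbers (in binary): `GT(x,y) = 1` iff `x ≥ y`. -/
def GTFun (n : ℕ) (x y : BitString n) : Bool := decide (Nat.ofBits x ≥ Nat.ofBits y)

/-- The VC-dimension of `f`: the maximal size of a set `S` of columns `y` such that every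
`R ⊆ S` is the set of all `y ∈ S` with `f x y = 1`, for some row `x`. -/
def vcDimension {n : ℕ} (f : BitString n → BitString n → Bool) : ℕ :=
  (Finset.univ.image fun x => Finset.univ.filter fun y => f x y = true).vcDim

/-- A quantum one-way protocol on `n`-bit inputs with `c` qubits of communication.
Alice owns `kept + c` private qubits and Bob owns `own` private qubits, all initialized to `|0⟩`.
On input `x` Alice applies the unitary transformation `alice x` to her qubits and sends the last
`c` of them to Bob. On input `y` Bob applies the unitary transformation `bob y` to the `c` qubits
received together with his own ones, and measures the qubit `out` in the standard basis.
There is neither prior entanglement nor shared randomness. -/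
structure OneWayProtocol (n c : ℕ) where
  /-- the number of qubits that Alice keeps -/
  kept : ℕ
  /-- the number of qubits that Bob owns at the beginning -/
  own : ℕ
  /-- Alice's transformation of her qubits -/
  alice : BitString n → Matrix.unitaryGroup (BitString kept × BitString c) ℂ
  /-- Bob's transformation of the qubits in his possession after the transmission -/
  bob : BitString n → Matrix.unitaryGroup (BitString c × BitString own) ℂ
  /-- the output qubit, one of those in Bob's possession -/
  out : Fin c ⊕ Fin own

namespace OneWayProtocol

variable {n c : ℕ} (P : OneWayProtocol n c)

/-- The initial state `|0…0⟩` of all qubits. -/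
def initialState : (BitString P.kept × BitString c) × BitString P.own → ℂ :=
  Pi.single ((zeroString _, zeroString _), zeroString _) 1

/-- The state of all qubits after Alice's transformation. -/
def stateAfterAlice (x : BitString n) : (BitString P.kept × BitString c) × BitString P.own → ℂ :=
  ((P.alice x : Matrix _ _ ℂ) ⊗ₖ (1 : Matrix (BitString P.own) (BitString P.own) ℂ)) *ᵥ
    P.initialState

/-- The same state after the transmission, which only changes the possession of the qubits. -/
def stateAfterSending (x : BitString n) : BitString P.kept × (BitString c × BitString P.own) → ℂ :=
  P.stateAfterAlice x ∘ (Equiv.prodAssoc _ _ _).symm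

/-- The state of all qubits after Bob's transformation. -/
def finalState (x y : BitString n) : BitString P.kept × (BitString c × BitString P.own) → ℂ :=
  ((1 : Matrix (BitString P.kept) (BitString P.kept) ℂ) ⊗ₖ (P.bob y : Matrix _ _ ℂ)) *ᵥ
    P.stateAfterSending x

/-- The value of the output qubit in the basis vector `|s⟩`. -/
def outBit (s : BitString P.kept × (BitString c × BitString P.own)) : Bool :=
  Sum.elim s.2.1 s.2.2 P.out

/-- The probability that the output is `v` on the inputs `x`, `y`: the squared length of the
projection of the final state onto the space spanned by the `|s⟩` with output qubit `v`. -/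
noncomputable def outputProb (x y : BitString n) (v : Bool) : ℝ :=
  ∑ s with P.outBit s = v, ‖P.finalState x y s‖ ^ 2

/-- On all inputs the protocol outputs the correct value with probability at least `1 - ε`. -/
def ComputesWithError (f : BitString n → BitString n → Bool) (ε : ℝ) : Prop :=
  ∀ x y, 1 - ε ≤ P.outputProb x y (f x y)

end OneWayProtocol

/-- The quantum one-way communication complexity `Q¹_ε(f)`: the least number `c` of qubits such
that some one-way protocol with `c` qubits of communication computes `f` with error `ε`. -/
noncomputable def quantumOneWay {n : ℕ} (ε : ℝ) (f : BitString n → BitString n → Bool) : ℕ :=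
  sInf {c | ∃ P : OneWayProtocol n c, P.ComputesWithError f ε}

/-! A protocol for `GT_n` lets Bob find `x` by binary search. Run `k` copies of it and take
majorities: by a Chernoff bound the error falls to `r ^ k` with `r < 1` depending only on `ε`, hence
to `1 / (4 n²)` for some `k = O(log n)`. A projection that confirms the right answer moves the state
by the square root of its error probability, so the `n` questions together move it by at most `1 /
2`, and the search ends at `x` with probability at least `1 / 4`.

On the other hand, the search is one measurement with `2 ^ n` outcomes, and the received state lives
in a space of dimension `2 ^ (c k)`. Success probabilities summed over `x` are at most this
dimension (`two_pow_le_of_small_error`), so `n ≤ 2 + c k`.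

Alice's kept qubits make Bob's state mixed; it is handled as a family of unnormalised vectors
indexed by the basis states `a` of these qubits. -/

section Search

/-! ### Binary search by successive measurements -/

variable {H : Type*} [NormedAddCommGroup H] [NormedSpace ℂ H]

/-- Binary search for `x` in the interval `[lo, lo + 2 ^ m)` by successive two-outcome measurements:
`Q y b` is the projection for the answer `b` to the question whether `y ≤ x`. The map returned
is the product of the projections for the answers that lead to `x`. -/
def searchMap (Q : ℕ → Bool → H →ₗ[ℂ] H) (x : ℕ) : ℕ → ℕ → H →ₗ[ℂ] H
  | 0, _ => LinearMap.id
  | m + 1, lo =>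
    if lo + 2 ^ m ≤ x then searchMap Q x m (lo + 2 ^ m) ∘ₗ Q (lo + 2 ^ m) true
    else searchMap Q x m lo ∘ₗ Q (lo + 2 ^ m) false

variable {Q : ℕ → Bool → H →ₗ[ℂ] H}

/-- The leaves of the search tree form a complete measurement: each node splits the squared norm
between its two branches. -/
theorem sum_norm_sq_searchMap
    (hQ : ∀ y w, ‖Q y true w‖ ^ 2 + ‖Q y false w‖ ^ 2 = ‖w‖ ^ 2) (m lo : ℕ) (w : H) :
    ∑ x ∈ Finset.Ico lo (lo + 2 ^ m), ‖searchMap Q x m lo w‖ ^ 2 = ‖w‖ ^ 2 := by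
  induction m generalizing lo w with
  | zero => simp [searchMap]
  | succ m ih =>
    rw [← Finset.sum_Ico_consecutive _ (Nat.le_add_right lo (2 ^ m))
      (show lo + 2 ^ m ≤ lo + 2 ^ (m + 1) by rw [pow_succ]; omega), add_comm, ← hQ (lo + 2 ^ m) w,
      ← ih (lo + 2 ^ m) (Q (lo + 2 ^ m) true w), ← ih lo (Q (lo + 2 ^ m) false w)]
    congr 1
    · rw [show lo + 2 ^ (m + 1) = lo + 2 ^ m + 2 ^ m by rw [pow_succ]; omega]
      refine Finset.sum_congr rfl fun x hx => ?_
      rw [searchMap, if_pos (Finset.mem_Ico.1 hx).1]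
      rfl
    · refine Finset.sum_congr rfl fun x hx => ?_
      rw [searchMap, if_neg (not_le.2 (Finset.mem_Ico.1 hx).2)]
      rfl

theorem norm_apply_le_of_norm_sq_add
    (hQ : ∀ y w, ‖Q y true w‖ ^ 2 + ‖Q y false w‖ ^ 2 = ‖w‖ ^ 2) (y : ℕ) (b : Bool) (w : H) :
    ‖Q y b w‖ ≤ ‖w‖ := by
  refine le_of_sq_le_sq ?_ (norm_nonneg _)
  have := hQ y w
  cases b <;> nlinarith [sq_nonneg ‖Q y true w‖, sq_nonneg ‖Q y false w‖]

theorem norm_searchMap_le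
    (hQ : ∀ y w, ‖Q y true w‖ ^ 2 + ‖Q y false w‖ ^ 2 = ‖w‖ ^ 2) (x m lo : ℕ) (w : H) :
    ‖searchMap Q x m lo w‖ ≤ ‖w‖ := by
  induction m generalizing lo w with
  | zero => simp [searchMap]
  | succ m ih =>
    rw [searchMap]
    split_ifs <;> exact (ih _ _).trans (norm_apply_le_of_norm_sq_add hQ _ _ _)

/-- The `y i` are the questions on the path to `x`. Since the search maps are contractions, the
disturbances add up, each measured on the original `w` rather than on the intermediate states. -/
theorem exists_norm_sub_searchMap_le
    (hQ : ∀ y w, ‖Q y true w‖ ^ 2 + ‖Q y false w‖ ^ 2 = ‖w‖ ^ 2) (x m lo : ℕ) :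
    ∃ y : Fin m → ℕ, (∀ i, y i < lo + 2 ^ m) ∧
      ∀ w, ‖w - searchMap Q x m lo w‖ ≤ ∑ i, ‖w - Q (y i) (decide (y i ≤ x)) w‖ := by
  induction m generalizing lo with
  | zero => exact ⟨Fin.elim0, fun i => i.elim0, fun w => by simp [searchMap]⟩
  | succ m ih =>
    have hpow : 0 < 2 ^ m := by positivity
    have key : ∃ lo' ≤ lo + 2 ^ m, searchMap Q x (m + 1) lo =
        searchMap Q x m lo' ∘ₗ Q (lo + 2 ^ m) (decide (lo + 2 ^ m ≤ x)) := by
      rw [searchMap]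
      split_ifs with h
      · exact ⟨_, le_rfl, by simp [h]⟩
      · exact ⟨lo, by omega, by simp [h]⟩
    obtain ⟨lo', hlo, hs⟩ := key
    obtain ⟨y, hy, hyw⟩ := ih lo'
    refine ⟨Fin.cons (lo + 2 ^ m) y, fun i => ?_, fun w => ?_⟩
    · refine Fin.cases ?_ (fun j => ?_) i
      · simp only [Fin.cons_zero, pow_succ]; omega
      · have := hy j
        simp only [Fin.cons_succ, pow_succ]; omega
    · rw [Fin.sum_univ_succ, hs]
      simp only [Fin.cons_zero, Fin.cons_succ, LinearMap.comp_apply]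
      set v := Q (lo + 2 ^ m) (decide (lo + 2 ^ m ≤ x)) w
      calc ‖w - searchMap Q x m lo' v‖
          = ‖searchMap Q x m lo' (w - v) + (w - searchMap Q x m lo' w)‖ := by
            rw [map_sub]; congr 1; abel
        _ ≤ ‖w - v‖ + ∑ i, ‖w - Q (y i) (decide (y i ≤ x)) w‖ :=
            (norm_add_le _ _).trans (add_le_add (norm_searchMap_le hQ _ _ _ _) (hyw w))

end Search

/-! ### Tensor powers of unitary matrices -/

section TensorPower

variable {γ : Type*} [Fintype γ]

/-- The `k`-fold tensor power of a matrix. -/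
def Matrix.tensorPow (k : ℕ) (M : Matrix γ γ ℂ) : Matrix (Fin k → γ) (Fin k → γ) ℂ :=
  Matrix.of fun s t => ∏ i, M (s i) (t i)

theorem Matrix.tensorPow_mulVec_prod (k : ℕ) (M : Matrix γ γ ℂ) (v : Fin k → γ → ℂ) :
    (M.tensorPow k *ᵥ fun t => ∏ i, v i (t i)) = fun s => ∏ i, (M *ᵥ v i) (s i) := by
  ext s
  simp only [Matrix.mulVec, dotProduct, Matrix.tensorPow, Matrix.of_apply]
  rw [Finset.prod_univ_sum, Fintype.piFinset_univ]
  simp [Finset.prod_mul_distrib]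

theorem Matrix.tensorPow_mem_unitaryGroup [DecidableEq γ] (k : ℕ) {M : Matrix γ γ ℂ}
    (hM : M ∈ Matrix.unitaryGroup γ ℂ) :
    M.tensorPow k ∈ Matrix.unitaryGroup (Fin k → γ) ℂ := by
  rw [Matrix.mem_unitaryGroup_iff] at hM ⊢
  ext s t
  have h : ∀ i, ∑ g, M (s i) g * star (M (t i) g) = if s i = t i then 1 else 0 := fun i => by
    have := congrFun (congrFun hM (s i)) (t i)
    simpa [Matrix.mul_apply, Matrix.one_apply] using this
  calc (M.tensorPow k * star (M.tensorPow k)) s t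
      = ∏ i, ∑ g, M (s i) g * star (M (t i) g) := by
        rw [Finset.prod_univ_sum, Fintype.piFinset_univ]
        simp [Matrix.mul_apply, Matrix.tensorPow, Finset.prod_mul_distrib]
    _ = (1 : Matrix (Fin k → γ) (Fin k → γ) ℂ) s t := by
        simp only [h, Matrix.one_apply, Finset.prod_ite_zero, Finset.prod_const_one,
          Finset.mem_univ, true_implies, funext_iff]

theorem Matrix.norm_toEuclideanLin_of_mem_unitaryGroup [DecidableEq γ] {M : Matrix γ γ ℂ}
    (hM : M ∈ Matrix.unitaryGroup γ ℂ) (w : EuclideanSpace ℂ γ) :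
    ‖Matrix.toEuclideanLin M w‖ = ‖w‖ := by
  have h := Matrix.mem_unitaryGroup_iff'.1 hM
  have h2 : Matrix.toEuclideanLin Mᴴ (Matrix.toEuclideanLin M w) = w := by
    ext i
    simp only [Matrix.toLpLin_apply, Matrix.mulVec_mulVec]
    rw [← Matrix.star_eq_conjTranspose, h, Matrix.one_mulVec]
  have h3 : inner ℂ (Matrix.toEuclideanLin M w) (Matrix.toEuclideanLin M w) = inner ℂ w w := by
    rw [← LinearMap.adjoint_inner_left, ← Matrix.toEuclideanLin_conjTranspose_eq_adjoint, h2]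
  rw [norm_eq_sqrt_re_inner (𝕜 := ℂ), h3, ← norm_eq_sqrt_re_inner]

end TensorPower

/-! ### Chernoff bound -/

section Chernoff

variable {γ : Type*} [Fintype γ]

/-- The product weight of the strings in which at least half of the letters are bad. -/
theorem sum_prod_le_of_half_bad (k : ℕ) (p : γ → ℝ) (hp : ∀ g, 0 ≤ p g) (bad : γ → Prop)
    [DecidablePred bad] {τ r : ℝ} (hτ : 1 ≤ τ)
    (h : ∑ g, p g * (if bad g then τ ^ 2 else 1) ≤ r * τ) :
    ∑ s : Fin k → γ with k ≤ 2 * (Finset.univ.filter fun i => bad (s i)).card, ∏ i, p (s i)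
      ≤ r ^ k := by
  have hτ0 : 0 < τ := by linarith
  have hpow : 0 < τ ^ k := by positivity
  refine le_of_mul_le_mul_right ?_ hpow
  rw [← mul_pow]
  refine le_trans ?_ (pow_le_pow_left₀ (Finset.sum_nonneg fun g _ => ?_) h k)
  · rw [Finset.sum_pow', Fintype.piFinset_univ, Finset.sum_mul]
    refine (Finset.sum_le_sum fun s hs => ?_).trans
      (Finset.sum_le_sum_of_subset_of_nonneg (Finset.filter_subset _ _) fun s _ _ => ?_)
    · rw [Finset.prod_mul_distrib]
      refine mul_le_mul_of_nonneg_left ?_ (Finset.prod_nonneg fun i _ => hp _)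
      -- Each bad letter contributes `τ ^ 2`, so half of them already give `τ ^ k`.
      rw [Finset.prod_ite, Finset.prod_const, Finset.prod_const_one, mul_one, ← pow_mul]
      exact pow_le_pow_right₀ hτ (Finset.mem_filter.1 hs).2
    · exact Finset.prod_nonneg fun i _ => mul_nonneg (hp _) (by split_ifs <;> positivity)
  · exact mul_nonneg (hp _) (by split_ifs <;> positivity)

/-- The parameters of the Chernoff bound for error probabilities `q ≤ ε < 1 / 2`. -/
theorem exists_chernoff_parameters {ε : ℝ} (h0 : 0 < ε) (h1 : ε < 1 / 2) :
    ∃ τ r : ℝ, 1 ≤ τ ∧ 0 < r ∧ r < 1 ∧ ∀ q ≤ ε, 1 - q + q * τ ^ 2 ≤ r * τ := by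
  have hpos : 0 < 1 - ε := by linarith
  have hge : 1 ≤ (1 - ε) / ε := by rw [le_div_iff₀ h0]; linarith
  have hτ1 : 1 ≤ √((1 - ε) / ε) := Real.one_le_sqrt.2 hge
  have hsq : √((1 - ε) / ε) ^ 2 = (1 - ε) / ε := Real.sq_sqrt (by positivity)
  set τ := √((1 - ε) / ε)
  have hτ0 : 0 < τ := by linarith
  have hετ : ε * τ ^ 2 = 1 - ε := by rw [hsq]; field_simp
  -- This `r` equals `2 √(ε (1 - ε))`, and the final inequality is an equality at `q = ε`.
  refine ⟨τ, 2 * (1 - ε) / τ, hτ1, by positivity, ?_, fun q hq => ?_⟩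
  · rw [div_lt_one hτ0]
    refine lt_of_pow_lt_pow_left₀ 2 hτ0.le ?_
    rw [hsq, lt_div_iff₀ h0]
    nlinarith [mul_pos hpos (sq_pos_of_pos (show 0 < 1 - 2 * ε by linarith))]
  · rw [div_mul_cancel₀ _ hτ0.ne']
    nlinarith [mul_nonneg (sub_nonneg.2 hq) (show 0 ≤ τ ^ 2 - 1 by nlinarith)]

end Chernoff

/-! ### Dimension bound for the search -/

section Search

variable {H : Type*} [NormedAddCommGroup H] [NormedSpace ℂ H]

/-- Cauchy–Schwarz makes the bound independent of the state, so that it can be summed over all `x`.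
-/
theorem sum_norm_sq_le_of_eq_sum_smul {κ β : Type*} [Fintype κ] [Fintype β] (T : H →ₗ[ℂ] H)
    (e : β → H) (χ : κ → β → ℂ) (hχ : ∑ a, ∑ b, ‖χ a b‖ ^ 2 ≤ 1) (ψ : κ → H)
    (hψ : ∀ a, ψ a = ∑ b, χ a b • e b) :
    ∑ a, ‖T (ψ a)‖ ^ 2 ≤ ∑ b, ‖T (e b)‖ ^ 2 := by
  have h : ∀ a, ‖T (ψ a)‖ ^ 2 ≤ (∑ b, ‖χ a b‖ ^ 2) * ∑ b, ‖T (e b)‖ ^ 2 := fun a => by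
    refine le_trans (pow_le_pow_left₀ (norm_nonneg _) ?_ 2)
      (Finset.sum_mul_sq_le_sq_mul_sq Finset.univ (fun b => ‖χ a b‖) fun b => ‖T (e b)‖)
    rw [hψ, map_sum]
    refine (norm_sum_le _ _).trans (Finset.sum_le_sum fun b _ => ?_)
    rw [map_smul, norm_smul]
  calc ∑ a, ‖T (ψ a)‖ ^ 2 ≤ (∑ a, ∑ b, ‖χ a b‖ ^ 2) * ∑ b, ‖T (e b)‖ ^ 2 := by
        rw [Finset.sum_mul]; exact Finset.sum_le_sum fun a _ => h a
    _ ≤ ∑ b, ‖T (e b)‖ ^ 2 :=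
        mul_le_of_le_one_left (Finset.sum_nonneg fun b _ => sq_nonneg _) hχ

/-- If the questions `y ≤ x` about a number `x < 2 ^ n` can be answered with a small error by
measuring a state `ψ x` whose part accessible to the measurement lies in the span of
vectors `e b`, then the number of these vectors is at least `2 ^ n / 4`. -/
theorem two_pow_le_of_small_error {n : ℕ} {Q : ℕ → Bool → H →ₗ[ℂ] H}
    (hQ : ∀ y w, ‖Q y true w‖ ^ 2 + ‖Q y false w‖ ^ 2 = ‖w‖ ^ 2)
    {κ β : Type*} [Fintype κ] [Fintype β] {e : β → H} (he : ∀ b, ‖e b‖ ≤ 1)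
    {χ : ℕ → κ → β → ℂ} (hχ : ∀ x < 2 ^ n, ∑ a, ∑ b, ‖χ x a b‖ ^ 2 ≤ 1) {ψ : ℕ → κ → H}
    (hψ : ∀ x a, ψ x a = ∑ b, χ x a b • e b) (hψ1 : ∀ x < 2 ^ n, ∑ a, ‖ψ x a‖ ^ 2 = 1) {δ : ℝ}
    (herr : ∀ x < 2 ^ n, ∀ y < 2 ^ n, ∑ a, ‖ψ x a - Q y (decide (y ≤ x)) (ψ x a)‖ ^ 2 ≤ δ)
    (hδ : (n : ℝ) ^ 2 * δ ≤ 1 / 4) :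
    (2 : ℝ) ^ n ≤ 4 * Fintype.card β := by
  have hsucc : ∀ x < 2 ^ n, 1 / 4 ≤ ∑ a, ‖searchMap Q x n 0 (ψ x a)‖ ^ 2 := fun x hx => by
    obtain ⟨y, hy, hyw⟩ := exists_norm_sub_searchMap_le hQ x n 0
    have hdist : ∑ a, ‖ψ x a - searchMap Q x n 0 (ψ x a)‖ ^ 2 ≤ 1 / 4 := by
      refine le_trans ?_ hδ
      calc ∑ a, ‖ψ x a - searchMap Q x n 0 (ψ x a)‖ ^ 2
          ≤ ∑ a, (n : ℝ) * ∑ i, ‖ψ x a - Q (y i) (decide (y i ≤ x)) (ψ x a)‖ ^ 2 := by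
            refine Finset.sum_le_sum fun a _ =>
              (pow_le_pow_left₀ (norm_nonneg _) (hyw (ψ x a)) 2).trans ?_
            simpa using sq_sum_le_card_mul_sum_sq (s := Finset.univ)
              (f := fun i => ‖ψ x a - Q (y i) (decide (y i ≤ x)) (ψ x a)‖)
        _ = (n : ℝ) * ∑ i, ∑ a, ‖ψ x a - Q (y i) (decide (y i ≤ x)) (ψ x a)‖ ^ 2 := by
            rw [← Finset.mul_sum, Finset.sum_comm]
        _ ≤ (n : ℝ) * ∑ _i : Fin n, δ := by
            gcongr with i
            exact herr x hx _ (by simpa using hy i)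
        _ = (n : ℝ) ^ 2 * δ := by simp; ring
    have hsplit : ∑ a, ‖ψ x a‖ ^ 2 ≤ ∑ a, (2 * ‖ψ x a - searchMap Q x n 0 (ψ x a)‖ ^ 2 +
        2 * ‖searchMap Q x n 0 (ψ x a)‖ ^ 2) := by
      refine Finset.sum_le_sum fun a _ => ?_
      have h := norm_add_le (ψ x a - searchMap Q x n 0 (ψ x a)) (searchMap Q x n 0 (ψ x a))
      rw [sub_add_cancel] at h
      have := pow_le_pow_left₀ (norm_nonneg _) h 2
      have := sq_nonneg (‖ψ x a - searchMap Q x n 0 (ψ x a)‖ - ‖searchMap Q x n 0 (ψ x a)‖)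
      linarith
    rw [hψ1 x hx, Finset.sum_add_distrib, ← Finset.mul_sum, ← Finset.mul_sum] at hsplit
    linarith
  have hsum : ∑ x ∈ Finset.Ico 0 (0 + 2 ^ n), (1 / 4 : ℝ) ≤ ∑ _b : β, (1 : ℝ) := by
    calc ∑ x ∈ Finset.Ico 0 (0 + 2 ^ n), (1 / 4 : ℝ)
        ≤ ∑ x ∈ Finset.Ico 0 (0 + 2 ^ n), ∑ b, ‖searchMap Q x n 0 (e b)‖ ^ 2 := by
          refine Finset.sum_le_sum fun x hx => ?_
          have hx' : x < 2 ^ n := by simpa using hx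
          exact (hsucc x hx').trans
            (sum_norm_sq_le_of_eq_sum_smul _ e (χ x) (hχ x hx') (ψ x) (hψ x))
      _ ≤ ∑ _b : β, (1 : ℝ) := by
          rw [Finset.sum_comm]
          refine Finset.sum_le_sum fun b _ => ?_
          rw [sum_norm_sq_searchMap hQ]
          exact pow_le_one₀ (norm_nonneg _) (he b)
  simp at hsum
  linarith

end Search

/-! ### Two-outcome projective measurements -/

section Measurement

variable {γ : Type*} [Fintype γ] [DecidableEq γ]

/-- The projection for the outcome `v` of the measurement that applies `U` and then reads off the
value of `p` in the standard basis. -/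
noncomputable def measureProj (U : Matrix γ γ ℂ) (p : γ → Bool) (v : Bool) :
    EuclideanSpace ℂ γ →ₗ[ℂ] EuclideanSpace ℂ γ :=
  Matrix.toEuclideanLin (Uᴴ * Matrix.diagonal (fun s => if p s = v then 1 else 0) * U)

variable {U : Matrix γ γ ℂ}

theorem norm_measureProj_sq (hU : U ∈ Matrix.unitaryGroup γ ℂ) (p : γ → Bool) (v : Bool)
    (w : EuclideanSpace ℂ γ) :
    ‖measureProj U p v w‖ ^ 2 = ∑ s with p s = v, ‖(U *ᵥ w.ofLp) s‖ ^ 2 := by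
  have h : measureProj U p v w = Matrix.toEuclideanLin Uᴴ
      (WithLp.toLp 2 fun s => if p s = v then (U *ᵥ w.ofLp) s else 0) := by
    ext s
    simp only [measureProj, Matrix.toLpLin_apply, ← Matrix.mulVec_mulVec]
    congr 2
    ext t
    simp [Matrix.mulVec_diagonal]
  rw [h, ← Matrix.star_eq_conjTranspose,
    Matrix.norm_toEuclideanLin_of_mem_unitaryGroup (Unitary.star_mem hU), EuclideanSpace.norm_sq_eq,
    Finset.sum_filter]
  refine Finset.sum_congr rfl fun s _ => ?_
  split_ifs with hs <;> simp [hs]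

theorem sum_norm_mulVec_sq (hU : U ∈ Matrix.unitaryGroup γ ℂ) (w : γ → ℂ) : ∑ s, ‖(U *ᵥ w) s‖ ^ 2 = ∑ s, ‖w s‖ ^ 2 := by
  have := Matrix.norm_toEuclideanLin_of_mem_unitaryGroup hU (WithLp.toLp 2 w)
  have := congrArg (· ^ 2) this
  simpa [EuclideanSpace.norm_sq_eq] using this

theorem norm_measureProj_sq_add (hU : U ∈ Matrix.unitaryGroup γ ℂ) (p : γ → Bool)
    (w : EuclideanSpace ℂ γ) :
    ‖measureProj U p true w‖ ^ 2 + ‖measureProj U p false w‖ ^ 2 = ‖w‖ ^ 2 := by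
  rw [norm_measureProj_sq hU, norm_measureProj_sq hU, EuclideanSpace.norm_sq_eq,
    ← sum_norm_mulVec_sq hU,
    ← Finset.sum_filter_add_sum_filter_not Finset.univ (fun s => p s = true)]
  simp

/-- Hence the squared disturbance caused by the right answer is exactly the probability of the wrong
one. -/
theorem sub_measureProj (hU : U ∈ Matrix.unitaryGroup γ ℂ) (p : γ → Bool) (v : Bool)
    (w : EuclideanSpace ℂ γ) :
    w - measureProj U p v w = measureProj U p (!v) w := by
  rw [sub_eq_iff_eq_add]
  have h : Matrix.diagonal (fun s => if p s = !v then (1 : ℂ) else 0) +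
      Matrix.diagonal (fun s => if p s = v then (1 : ℂ) else 0) = 1 := by
    rw [Matrix.diagonal_add, ← Matrix.diagonal_one]
    congr 1
    ext s
    cases p s <;> cases v <;> simp
  rw [measureProj, measureProj, ← LinearMap.add_apply, ← map_add, ← add_mul, ← mul_add, h, mul_one,
    ← Matrix.star_eq_conjTranspose, Matrix.mem_unitaryGroup_iff'.1 hU]
  simp

end Measurement

/-! ### Majority vote on independent copies -/

section Amplification

variable {γ : Type*}

/-- The majority of the bits of `k` measurement outcomes, with ties counted as `false`. -/
def majorityBit (bit : γ → Bool) (k : ℕ) (s : Fin k → γ) : Bool :=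
  decide (k < 2 * (Finset.univ.filter fun i => bit (s i) = true).card)

theorem le_two_mul_card_of_majorityBit_eq_not {bit : γ → Bool} {k : ℕ} {s : Fin k → γ} {v : Bool}
    (h : majorityBit bit k s = !v) :
    k ≤ 2 * (Finset.univ.filter fun i => bit (s i) ≠ v).card := by
  have hc := Finset.card_filter_add_card_filter_not (s := (Finset.univ : Finset (Fin k)))
    (fun i => bit (s i) = true)
  rw [Finset.card_univ, Fintype.card_fin] at hc
  cases v
  · simp only [majorityBit, Bool.not_false, decide_eq_true_eq] at h
    simp only [ne_eq, Bool.not_eq_false]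
    omega
  · simp only [majorityBit, Bool.not_true, decide_eq_false_iff_not] at h
    simp only [ne_eq]
    omega

theorem sum_prod_norm_sq {κ : Type*} [Fintype κ] (k : ℕ) (σ : κ → γ → ℂ) (S : Finset (Fin k → γ)) :
    ∑ a : Fin k → κ, ∑ s ∈ S, ‖∏ i, σ (a i) (s i)‖ ^ 2 =
      ∑ s ∈ S, ∏ i, ∑ a, ‖σ a (s i)‖ ^ 2 := by
  rw [Finset.sum_comm]
  refine Finset.sum_congr rfl fun s _ => ?_
  rw [Finset.prod_univ_sum, Fintype.piFinset_univ]
  simp [Finset.prod_pow]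

variable [Fintype γ] [DecidableEq γ]

/-- The error of the majority vote on `k` copies of a state. -/
theorem sum_norm_sub_measureProj_tensorPow_le {κ : Type*} [Fintype κ] {U : Matrix γ γ ℂ}
    (hU : U ∈ Matrix.unitaryGroup γ ℂ) (bit : γ → Bool) (k : ℕ) (v : Bool) {σ : κ → γ → ℂ}
    (hσ : ∑ a, ∑ g, ‖σ a g‖ ^ 2 = 1) {ε τ r : ℝ} (hτ : 1 ≤ τ)
    (hr : ∀ q ≤ ε, 1 - q + q * τ ^ 2 ≤ r * τ)
    (herr : ∑ a, ∑ g with bit g ≠ v, ‖(U *ᵥ σ a) g‖ ^ 2 ≤ ε) :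
    ∑ a : Fin k → κ, ‖WithLp.toLp 2 (fun s : Fin k → γ => ∏ i, σ (a i) (s i)) -
      measureProj (U.tensorPow k) (majorityBit bit k) v
        (WithLp.toLp 2 fun s => ∏ i, σ (a i) (s i))‖ ^ 2 ≤ r ^ k := by
  have hUk := Matrix.tensorPow_mem_unitaryGroup k hU
  have hp0 : ∀ g, 0 ≤ ∑ a, ‖(U *ᵥ σ a) g‖ ^ 2 :=
    fun g => Finset.sum_nonneg fun a _ => sq_nonneg _
  have htot : ∑ g, ∑ a, ‖(U *ᵥ σ a) g‖ ^ 2 = 1 := by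
    rw [Finset.sum_comm, ← hσ]
    exact Finset.sum_congr rfl fun a _ => sum_norm_mulVec_sq hU _
  rw [Finset.sum_comm] at herr
  have hsplit := Finset.sum_filter_add_sum_filter_not Finset.univ (fun g => bit g ≠ v)
    (fun g => ∑ a, ‖(U *ᵥ σ a) g‖ ^ 2)
  simp only [sub_measureProj hUk, norm_measureProj_sq hUk, Matrix.tensorPow_mulVec_prod]
  rw [sum_prod_norm_sq k (fun a => U *ᵥ σ a)]
  refine le_trans (Finset.sum_le_sum_of_subset_of_nonneg (fun s hs => ?_) fun s _ _ =>
    Finset.prod_nonneg fun i _ => hp0 (s i)) (sum_prod_le_of_half_bad k _ hp0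
      (fun g => bit g ≠ v) hτ (r := r) ?_)
  · exact Finset.mem_filter.2 ⟨Finset.mem_univ _,
      le_two_mul_card_of_majorityBit_eq_not (Finset.mem_filter.1 hs).2⟩
  · refine le_trans (le_of_eq ?_) (hr _ herr)
    rw [← Finset.sum_filter_add_sum_filter_not Finset.univ (fun g => bit g ≠ v),
      Finset.sum_congr rfl (g := fun g => (∑ a, ‖(U *ᵥ σ a) g‖ ^ 2) * τ ^ 2) fun g hg => by
        rw [if_pos (Finset.mem_filter.1 hg).2],
      Finset.sum_congr rfl (g := fun g => ∑ a, ‖(U *ᵥ σ a) g‖ ^ 2)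
        (s₁ := Finset.univ.filter fun g => ¬ bit g ≠ v) fun g hg => by
          rw [if_neg (Finset.mem_filter.1 hg).2, mul_one],
      ← Finset.sum_mul]
    linarith

/-- The lower bound for the number of basis vectors `J b` spanning the transmitted part of the
states `σ x` from which the questions `y ≤ x` can be answered with error `ε`. -/
theorem two_pow_le_card_pow {n k : ℕ} {κ β : Type*} [Fintype κ] [Fintype β]
    {U : ℕ → Matrix γ γ ℂ} (hU : ∀ y, U y ∈ Matrix.unitaryGroup γ ℂ) (bit : γ → Bool) {J : β → γ}
    {χ : ℕ → κ → β → ℂ} (hχ : ∀ x, ∑ a, ∑ b, ‖χ x a b‖ ^ 2 = 1) {σ : ℕ → κ → γ → ℂ}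
    (hσ : ∀ x a g, σ x a g = ∑ b, χ x a b * if g = J b then 1 else 0)
    (hσ1 : ∀ x, ∑ a, ∑ g, ‖σ x a g‖ ^ 2 = 1) {ε τ r : ℝ} (hτ : 1 ≤ τ)
    (hr : ∀ q ≤ ε, 1 - q + q * τ ^ 2 ≤ r * τ)
    (herr : ∀ x < 2 ^ n, ∀ y < 2 ^ n,
      ∑ a, ∑ g with bit g ≠ decide (y ≤ x), ‖(U y *ᵥ σ x a) g‖ ^ 2 ≤ ε)
    (hk : (n : ℝ) ^ 2 * r ^ k ≤ 1 / 4) :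
    (2 : ℝ) ^ n ≤ 4 * (Fintype.card β : ℝ) ^ k := by
  have key := two_pow_le_of_small_error (n := n) (H := EuclideanSpace ℂ (Fin k → γ))
    (Q := fun y => measureProj ((U y).tensorPow k) (majorityBit bit k))
    (fun y w => norm_measureProj_sq_add (Matrix.tensorPow_mem_unitaryGroup k (hU y)) _ w)
    (κ := Fin k → κ) (β := Fin k → β) (e := fun b => EuclideanSpace.single (fun i => J (b i)) 1)
    (fun b => by simp) (χ := fun x a b => ∏ i, χ x (a i) (b i)) (fun x _ => ?_)
    (ψ := fun x a => WithLp.toLp 2 fun s => ∏ i, σ x (a i) (s i)) (fun x a => ?_) (fun x _ => ?_)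
    (fun x hx y hy => sum_norm_sub_measureProj_tensorPow_le (hU y) bit k _ (hσ1 x) hτ hr
      (herr x hx y hy)) hk
  · simpa using key
  · rw [sum_prod_norm_sq, ← Fintype.sum_pow (fun b => ∑ a, ‖χ x a b‖ ^ 2), Finset.sum_comm, hχ, one_pow]
  · ext s
    simp only [hσ, WithLp.ofLp_sum, WithLp.ofLp_smul, Finset.sum_apply, Pi.smul_apply, smul_eq_mul,
      PiLp.single_apply]
    rw [Finset.prod_univ_sum, Fintype.piFinset_univ]
    refine Finset.sum_congr rfl fun b _ => ?_
    rw [Finset.prod_mul_distrib]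
    simp only [Finset.prod_ite_zero, Finset.prod_const_one, Finset.mem_univ, true_implies,
      funext_iff]
  · simp only [EuclideanSpace.norm_sq_eq]
    rw [sum_prod_norm_sq, ← Fintype.sum_pow (fun g => ∑ a, ‖σ x a g‖ ^ 2), Finset.sum_comm, hσ1,
      one_pow]

end Amplification

/-! ### Application to one-way protocols -/

namespace OneWayProtocol

variable {n c : ℕ} (P : OneWayProtocol n c)

theorem stateAfterSending_apply (x : BitString n) (a : BitString P.kept) (b : BitString c)
    (w : BitString P.own) :
    P.stateAfterSending x (a, (b, w)) =
      (P.alice x).1 (a, b) (zeroString _, zeroString _) *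
        if w = zeroString _ then 1 else 0 := by
  simp [stateAfterSending, stateAfterAlice, initialState, Matrix.one_apply]

theorem finalState_apply (x y : BitString n) (a : BitString P.kept)
    (g : BitString c × BitString P.own) :
    P.finalState x y (a, g) =
      ((P.bob y).1 *ᵥ fun t => P.stateAfterSending x (a, t)) g := by
  rw [finalState, Matrix.mulVec, dotProduct, Fintype.sum_prod_type,
    Finset.sum_eq_single a (fun a' _ h => by simp [h.symm]) (by simp)]
  simp [Matrix.mulVec, dotProduct]

theorem sum_norm_alice_sq (x : BitString n) :
    ∑ a, ∑ b, ‖(P.alice x).1 (a, b) (zeroString _, zeroString _)‖ ^ 2 = 1 := by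
  have h := sum_norm_mulVec_sq (P.alice x).2 (Pi.single (zeroString _, zeroString _) 1)
  rw [Matrix.mulVec_single_one, Fintype.sum_prod_type,
    Finset.sum_eq_single (zeroString P.kept, zeroString c)
      (fun b _ hb => by simp [Pi.single_eq_of_ne hb]) (by simp)] at h
  simpa using h

theorem sum_norm_stateAfterSending_sq (x : BitString n) :
    ∑ a, ∑ g, ‖P.stateAfterSending x (a, g)‖ ^ 2 = 1 := by
  rw [← P.sum_norm_alice_sq x]
  refine Finset.sum_congr rfl fun a _ => ?_
  rw [Fintype.sum_prod_type]
  refine Finset.sum_congr rfl fun b _ => ?_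
  rw [Finset.sum_eq_single (zeroString P.own)
    (fun w _ h => by simp [stateAfterSending_apply, h]) (by simp)]
  simp [stateAfterSending_apply]

theorem sum_norm_finalState_sq (x y : BitString n) : ∑ s, ‖P.finalState x y s‖ ^ 2 = 1 := by
  rw [Fintype.sum_prod_type, ← P.sum_norm_stateAfterSending_sq x]
  refine Finset.sum_congr rfl fun a _ => ?_
  simp only [finalState_apply]
  exact sum_norm_mulVec_sq (P.bob y).2 _

theorem sum_outBit_ne (x y : BitString n) (v : Bool) :
    ∑ s with P.outBit s ≠ v, ‖P.finalState x y s‖ ^ 2 = 1 - P.outputProb x y v := by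
  rw [← P.sum_norm_finalState_sq x y, outputProb,
    ← Finset.sum_filter_add_sum_filter_not Finset.univ (fun s => P.outBit s = v)]
  ring

theorem two_pow_le_of_computesWithError {ε τ r : ℝ} (hP : P.ComputesWithError (GTFun n) ε)
    (hτ : 1 ≤ τ) (hr : ∀ q ≤ ε, 1 - q + q * τ ^ 2 ≤ r * τ) {k : ℕ}
    (hk : (n : ℝ) ^ 2 * r ^ k ≤ 1 / 4) :
    (2 : ℝ) ^ n ≤ 4 * (2 ^ c) ^ k := by
  let bits : ℕ → BitString n := fun x i => x.testBit i
  have hbits : ∀ x < 2 ^ n, Nat.ofBits (bits x) = x := fun x hx => by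
    rw [Nat.ofBits_testBit, Nat.mod_eq_of_lt hx]
  -- Bob's own qubits start in `|0⟩`, so only the `2 ^ c` vectors `|b, 0⟩` count, however many
  -- qubits he owns.
  have key := two_pow_le_card_pow (n := n) (k := k) (fun y => (P.bob (bits y)).2)
    (fun g => Sum.elim g.1 g.2 P.out) (J := fun b => (b, zeroString P.own))
    (fun x => P.sum_norm_alice_sq (bits x))
    (σ := fun x a g => P.stateAfterSending (bits x) (a, g)) (fun x a g => ?_)
    (fun x => P.sum_norm_stateAfterSending_sq (bits x)) hτ hr (fun x hx y hy => ?_) hk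
  · simpa using key
  · obtain ⟨b, w⟩ := g
    rw [stateAfterSending_apply, Finset.sum_eq_single b
      (fun b' _ h => by simp [h.symm]) (by simp)]
    simp
  · have h := hP (bits x) (bits y)
    have h2 := P.sum_outBit_ne (bits x) (bits y) (GTFun n (bits x) (bits y))
    rw [GTFun, hbits x hx, hbits y hy] at h h2
    rw [Finset.sum_filter, Fintype.sum_prod_type] at h2
    simp only [← finalState_apply, Finset.sum_filter]
    exact h2.trans_le (by linarith)

end OneWayProtocol

/-! ### The trivial protocol -/

theorem Equiv.Perm.permMatrix_mem_unitaryGroup {γ : Type*} [Fintype γ] [DecidableEq γ]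
    (σ : Equiv.Perm γ) : σ.permMatrix ℂ ∈ Matrix.unitaryGroup γ ℂ := by
  rw [Matrix.mem_unitaryGroup_iff, Matrix.star_eq_conjTranspose, Matrix.conjTranspose_permMatrix,
    ← Matrix.permMatrix_mul]
  simp

/-- Bob's classical computation of `f x y` from `x`, whose result is added to his own bit. -/
def xorPerm {n : ℕ} (f : BitString n → BitString n → Bool) (y : BitString n) :
    Equiv.Perm (BitString n × BitString 1) :=
  Function.Involutive.toPerm (fun g => (g.1, fun i => xor (g.2 i) (f g.1 y))) fun g => by simp

/-- The protocol in which Alice sends her whole input. -/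
def trivialProtocol {n : ℕ} (f : BitString n → BitString n → Bool) : OneWayProtocol n n where
  kept := 0
  own := 1
  alice x := ⟨(Equiv.swap (zeroString 0, zeroString n) (zeroString 0, x)).permMatrix ℂ,
    Equiv.Perm.permMatrix_mem_unitaryGroup _⟩
  bob y := ⟨(xorPerm f y).permMatrix ℂ, Equiv.Perm.permMatrix_mem_unitaryGroup _⟩
  out := Sum.inr 0

theorem trivialProtocol_computes {n : ℕ} (f : BitString n → BitString n → Bool) {ε : ℝ}
    (hε : 0 ≤ ε) : (trivialProtocol f).ComputesWithError f ε := by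
  intro x y
  have h := (trivialProtocol f).sum_outBit_ne x y (f x y)
  rw [Finset.sum_eq_zero] at h
  · linarith
  rintro ⟨a, b, w⟩ hs
  have hw : w (0 : Fin 1) ≠ f x y := (Finset.mem_filter.1 hs).2
  have hbob : (trivialProtocol f).finalState x y (a, (b, w)) =
      (trivialProtocol f).stateAfterSending x (a, xorPerm f y (b, w)) := by
    rw [OneWayProtocol.finalState_apply]
    exact congrFun (Matrix.permMatrix_mulVec (xorPerm f y)) (b, w)
  have halice (hb : x ≠ b) :
      ((trivialProtocol f).alice x).1 (a, b) (zeroString _, zeroString _) = 0 := by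
    have hne : Equiv.swap (zeroString 0, zeroString n) (zeroString 0, x) (a, b) ≠
        (zeroString 0, zeroString n) := by
      rw [Ne, Equiv.swap_apply_eq_iff, Equiv.swap_apply_left]
      exact fun h => hb (congrArg Prod.snd h).symm
    exact if_neg fun h => hne (Option.some_injective _ h)
  have hx : xorPerm f y (b, w) = (b, fun i => xor (w i) (f b y)) := rfl
  rw [hbob, hx, OneWayProtocol.stateAfterSending_apply]
  by_cases hb : x = b
  · subst hb
    rw [if_neg, mul_zero, norm_zero, zero_pow two_ne_zero]
    intro h
    have h0 : xor (w (0 : Fin 1)) (f x y) = false := congrFun h (0 : Fin 1)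
    exact hw (by simpa using h0)
  · rw [halice hb, zero_mul, norm_zero, zero_pow two_ne_zero]

/-- The trivial protocol excludes the junk value `sInf ∅ = 0`. -/
theorem quantumOneWay_spec {n : ℕ} (f : BitString n → BitString n → Bool) {ε : ℝ} (hε : 0 ≤ ε) :
    ∃ P : OneWayProtocol n (quantumOneWay ε f), P.ComputesWithError f ε :=
  Nat.sInf_mem (s := {c | ∃ P : OneWayProtocol n c, P.ComputesWithError f ε})
    ⟨n, trivialProtocol f, trivialProtocol_computes f hε⟩

theorem exists_le_quantumOneWay_GTFun {ε : ℝ} (h0 : 0 < ε) (h1 : ε < 1 / 2) :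
    ∃ m : ℕ, 0 < m ∧ ∀ n : ℕ, n ≤ 2 + quantumOneWay ε (GTFun n) * (m * (Nat.log 2 n + 2)) := by
  obtain ⟨τ, r, hτ, hr0, hr1, hr⟩ := exists_chernoff_parameters h0 h1
  obtain ⟨m, hm⟩ := exists_pow_lt_of_lt_one (show (0 : ℝ) < 1 / 4 by norm_num) hr1
  have hm0 : 0 < m := by
    rcases Nat.eq_zero_or_pos m with rfl | h
    · norm_num at hm
    · exact h
  refine ⟨m, hm0, fun n => ?_⟩
  obtain ⟨P, hP⟩ := quantumOneWay_spec (GTFun n) h0.le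
  have hn : (n : ℝ) ≤ 2 ^ (Nat.log 2 n + 1) := by
    exact_mod_cast (Nat.lt_pow_succ_log_self one_lt_two n).le
  -- With `r ^ m < 1 / 4`, the power of `r` beats `n ^ 2 ≤ 4 ^ (Nat.log 2 n + 1)` by one more factor
  -- `1 / 4`.
  have hk : (n : ℝ) ^ 2 * r ^ (m * (Nat.log 2 n + 2)) ≤ 1 / 4 := by
    calc (n : ℝ) ^ 2 * r ^ (m * (Nat.log 2 n + 2))
        ≤ (2 ^ (Nat.log 2 n + 1)) ^ 2 * (1 / 4) ^ (Nat.log 2 n + 2) := by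
          rw [pow_mul r]
          gcongr
      _ = 1 / 4 := by
          rw [← pow_mul, mul_comm _ 2, pow_mul, pow_succ (1 / 4 : ℝ) (Nat.log 2 n + 1), ← mul_assoc,
            ← mul_pow]
          norm_num
  have h := P.two_pow_le_of_computesWithError hP hτ hr hk
  rw [← pow_mul, show (4 : ℝ) = 2 ^ 2 by norm_num, ← pow_add] at h
  exact (pow_le_pow_iff_right₀ one_lt_two).1 h

/-! ### VC-dimension and conclusion -/

theorem vcDimension_GTFun {n : ℕ} (hn : 1 ≤ n) : vcDimension (GTFun n) = 1 := by
  refine le_antisymm (Finset.sup_le fun S hS => ?_) ?_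
  · rw [Finset.mem_shatterer] at hS
    -- No `x` cuts out `{z}` alone, since `x ≥ z` forces `x ≥ y`.
    have key : ∀ y ∈ S, ∀ z ∈ S, Nat.ofBits y < Nat.ofBits z → False := fun y hy z hz hlt => by
      obtain ⟨u, hu, hSu⟩ := hS (Finset.singleton_subset_iff.2 hz)
      obtain ⟨x, -, rfl⟩ := Finset.mem_image.1 hu
      have h1 : z ∈ S ∩ Finset.univ.filter fun y => GTFun n x y = true := by simp [hSu]
      have h2 : y ∉ S ∩ Finset.univ.filter fun y => GTFun n x y = true := by
        rw [hSu, Finset.mem_singleton]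
        rintro rfl
        exact lt_irrefl _ hlt
      simp [GTFun, hy, hz] at h1 h2
      omega
    refine Finset.card_le_one.2 fun y hy z hz => ?_
    have heq : Nat.ofBits y = Nat.ofBits z :=
      le_antisymm (not_lt.1 (key z hz y hy)) (not_lt.1 (key y hy z hz))
    ext i
    rw [← Nat.testBit_ofBits_lt y i i.2, heq, Nat.testBit_ofBits_lt z i i.2]
  · have hshat : (Finset.univ.image fun x => Finset.univ.filter fun y => GTFun n x y = true).Shatters
        {fun _ : Fin n => true} := fun t ht => by
      have hpos : 0 < Nat.ofBits (fun _ : Fin n => true) := by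
        refine Nat.pos_of_ne_zero fun h => ?_
        have := Nat.testBit_ofBits_lt (fun _ : Fin n => true) 0 hn
        simp [h] at this
      have hzero : Nat.ofBits (zeroString n) = 0 :=
        Nat.eq_of_testBit_eq fun i => by simp [Nat.testBit_ofBits, zeroString]
      rcases Finset.subset_singleton_iff.1 ht with rfl | rfl
      · refine ⟨_, Finset.mem_image_of_mem _ (Finset.mem_univ (zeroString n)), ?_⟩
        ext y
        simp only [Finset.mem_inter, Finset.mem_singleton, Finset.mem_filter, GTFun, hzero]
        simp
        rintro rfl
        exact hpos.ne'
      · refine ⟨_, Finset.mem_image_of_mem _ (Finset.mem_univ fun _ => true), ?_⟩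
        ext y
        simp only [Finset.mem_inter, Finset.mem_singleton, GTFun]
        simp
        rintro rfl
        exact le_rfl
    exact hshat.card_le_vcDim

theorem corollary2 :
    (∀ ε : ℝ, 0 < ε → ε < 1 / 2 →
      ∃ C : ℝ, 0 < C ∧ ∃ N : ℕ, ∀ n : ℕ, N ≤ n →
        C * ((n : ℝ) / Real.log (n : ℝ)) ≤ (quantumOneWay ε (GTFun n) : ℝ)) ∧
    (∀ n : ℕ, 1 ≤ n → vcDimension (GTFun n) = 1) := by
  refine ⟨fun ε h0 h1 => ?_, fun n hn => vcDimension_GTFun hn⟩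
  obtain ⟨m, hm, hbound⟩ := exists_le_quantumOneWay_GTFun h0 h1
  have hm' : (0 : ℝ) < m := by exact_mod_cast hm
  have hlog2 : 0 < Real.log 2 := Real.log_pos one_lt_two
  -- For `n ≥ 4` both additive constants `2` are absorbed, each at the cost of a factor `2`.
  refine ⟨Real.log 2 / (4 * m), by positivity, 4, fun n hn => ?_⟩
  have hn' : (4 : ℝ) ≤ n := by exact_mod_cast hn
  have hlog : 0 < Real.log n := Real.log_pos (by linarith)
  have hb : (n : ℝ) ≤ 2 + quantumOneWay ε (GTFun n) * (m * (Nat.log 2 n + 2)) := by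
    exact_mod_cast hbound n
  have hl2 : (2 : ℝ) ≤ Nat.log 2 n := by
    exact_mod_cast Nat.le_log_of_pow_le one_lt_two hn
  have hl : Nat.log 2 n * Real.log 2 ≤ Real.log n := by
    have := Real.natLog_le_logb n 2
    rwa [Real.logb, le_div_iff₀ (by simpa using hlog2)] at this
  set q : ℝ := (quantumOneWay ε (GTFun n) : ℝ) with hq
  have hq0 : 0 ≤ q := Nat.cast_nonneg _
  have hn4 : (n : ℝ) ≤ 4 * q * m * Nat.log 2 n := by
    have : q * m * (Nat.log 2 n + 2) ≤ q * m * (2 * Nat.log 2 n) := by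
      gcongr
      linarith
    linarith
  rw [div_mul_div_comm, div_le_iff₀ (by positivity)]
  calc Real.log 2 * n ≤ Real.log 2 * (4 * q * m * Nat.log 2 n) := by gcongr
    _ = 4 * q * m * (Nat.log 2 n * Real.log 2) := by ring
    _ ≤ 4 * q * m * Real.log n := by gcongr
    _ = q * (4 * m * Real.log n) := by ring
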